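/- For a cardinal $\kappa$, let $\mathrm{MA}(\kappa)$ be the statement: for every nonempty partially ordered set $P$ in which every uncountable subset contains two distinct elements having a common upper bound in $P$, and for every family $(D_\xi)_{\xi<\kappa}$ of subsets of $P$ such that for each $\xi<\kappa$ and each $p\in P$ there is $d\in D_\xi$ with $p\le d$, there is a directed set $G\subseteq P$ (any two elements of $G$ have an upper bound in $G$) such that $G\cap D_\xi\neq\emptyset$ for all $\xi<\kappa$. A topological space $K$ is scattered if no nonempty subset of $K$ is dense-in-itself; its height is the least ordinal $\alpha$ such that the Cantor--Bendixson derivative $K^{(\alpha)}$ is empty. The weight of $K$ is the least cardinality of a base of $K$. $C(K)$ denotes the Banach space of continuous real-valued functions on $K$ with the supremum norm, and $c_0$ the Banach space of real sequences converging to $0$ with the supremum norm. A twisted sum of Banach spaces $Z$ and $Y$ is a short exact sequence $0\to Z\xrightarrow{i} X\xrightarrow{q} Y\to 0$ of Banach spaces and bounded linear operators; it is trivial if $i$ has a bounded linear left inverse $X\to Z$. **Theorem 8.7.** Let $\kappa$ be a cardinal and assume $\mathrm{MA}(\kappa)$. Let $K$ be a separable scattered compact Hausdorff space of height $3$ and weight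 $\kappa$. Then every twisted sum of $c_0$ and $C(K)$ is trivial. -/

import Mathlib

open scoped Cardinal ZeroAtInfty

universe u v w

/-- The countable chain condition, "upwards": every uncountable set of conditions contains two
distinct conditions with a common upper bound. -/
def SatisfiesCCC (P : Type u) [PartialOrder P] : Prop :=
  ∀ A : Set P, ¬ A.Countable → ∃ p ∈ A, ∃ q ∈ A, p ≠ q ∧ ∃ r : P, p ≤ r ∧ q ≤ r

/-- Martin's axiom `MA(κ)`: for every nonempty ccc partially ordered set `P` and every family of
`κ` many dense subsets of `P` there is a directed set meeting all of them. In the upward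
convention "dense" means that every condition lies below an element of the set, which is
Mathlib's `IsCofinal`. -/
def MartinMA (κ : Cardinal.{u}) : Prop :=
  ∀ (P : Type u) [PartialOrder P] [Nonempty P], SatisfiesCCC P →
    ∀ (ι : Type u), #ι = κ → ∀ D : ι → Set P, (∀ ξ, IsCofinal (D ξ)) →
      ∃ G : Set P, DirectedOn (· ≤ ·) G ∧ ∀ ξ, (G ∩ D ξ).Nonempty

/-- The weight of a topological space: the least cardinality of a base. -/
noncomputable def topWeight (K : Type u) [TopologicalSpace K] : Cardinal.{u} :=
  sInf {c | ∃ B : Set (Set K), TopologicalSpace.IsTopologicalBasis B ∧ #B = c}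

/-- A space is scattered if no nonempty subset is dense in itself. -/
def IsScatteredSpace (K : Type u) [TopologicalSpace K] : Prop :=
  ∀ A : Set K, A.Nonempty → ¬ Preperfect A

/-- The scattered height: the least ordinal `α` such that the `α`-th Cantor-Bendixson derivative
of the space is empty. (Such an `α` exists whenever the space is scattered.) -/
noncomputable def scatteredHeight (K : Type u) [TopologicalSpace K] : Ordinal.{u} :=
  sInf {α | CantorBendixson.iteratedDerivedSet (Set.univ : Set K) α = ∅}

/-- A twisted sum of `Z` and `Y`: the bounded operators `i` and `q` form a short exact sequence
`0 → Z → X → Y → 0` of Banach spaces. -/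
structure IsTwistedSum {Z : Type u} {X : Type v} {Y : Type w}
    [NormedAddCommGroup Z] [NormedSpace ℝ Z] [CompleteSpace Z]
    [NormedAddCommGroup X] [NormedSpace ℝ X] [CompleteSpace X]
    [NormedAddCommGroup Y] [NormedSpace ℝ Y] [CompleteSpace Y]
    (i : Z →L[ℝ] X) (q : X →L[ℝ] Y) : Prop where
  injective : Function.Injective i
  exact : Function.Exact i q
  surjective : Function.Surjective q

/-- The twisted sum of `Z` and `Y` with middle space `X` given by `i` and `q` is trivial: the
sequence splits, i.e. `i` has a bounded linear left inverse. -/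
structure IsTrivialTwistedSum {Z : Type u} {X : Type v} {Y : Type w}
    [NormedAddCommGroup Z] [NormedSpace ℝ Z] [CompleteSpace Z]
    [NormedAddCommGroup X] [NormedSpace ℝ X] [CompleteSpace X]
    [NormedAddCommGroup Y] [NormedSpace ℝ Y] [CompleteSpace Y]
    (i : Z →L[ℝ] X) (q : X →L[ℝ] Y) : Prop extends IsTwistedSum i q where
  splits : ∃ r : X →L[ℝ] Z, r.comp i = ContinuousLinearMap.id ℝ Z

open Filter Topology

/-! Extend the coordinate functionals of `c₀` to uniformly bounded functionals `ψ k` on `X` and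
compose them with a linear, possibly discontinuous section of `q`. The resulting `t k` on `C(K)` are
asymptotically bounded by a constant times the norm. The sequence splits once some bounded sequence
`μ k` in the dual satisfies `μ k - t k → 0` on a set with dense span: then `ψ k - μ k ∘ q` is
pointwise null and retracts `X` onto `c₀` (`IsTwistedSum.exists_functionals`).

Martin's axiom supplies `μ` (`CZeroSystem.exists_bounded_asymptotic`). A condition fixes finitely
many terms, taken from a multiple of a weak-star dense sequence, and promises finitely many
generators on which later terms follow `t`. The generators are peak functions at the points of the
three Cantor-Bendixson levels of `K`. The bottom level is countable and the top one finite; the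
middle one may be uncountable, but it behaves like `c₀(Γ)` modulo the others.

The crux is the ccc. Two conditions with the same terms and the same promises from the countable
part are compatible, because the bounds on `t` over their two spans amalgamate with a constant
independent of the conditions (`CZeroSystem.bound_union`). -/

/-- A linear functional bounded by `C` on a subspace agrees there with a bounded functional of
norm at most `C`. -/
theorem exists_dual_eq_on_of_bound {Y : Type*} [NormedAddCommGroup Y] [NormedSpace ℝ Y]
    (V : Submodule ℝ Y) (φ : Y →ₗ[ℝ] ℝ) {C : ℝ} (hC : 0 ≤ C) (h : ∀ y ∈ V, |φ y| ≤ C * ‖y‖) :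
    ∃ ν : StrongDual ℝ Y, ‖ν‖ ≤ C ∧ ∀ y ∈ V, ν y = φ y := by
  obtain ⟨ν, hν, hn⟩ := exists_extension_norm_eq V
    ((φ.domRestrict V).mkContinuous C fun y => h y y.2)
  refine ⟨ν, hn ▸ LinearMap.mkContinuous_norm_le _ hC _, fun y hy => ?_⟩
  exact hν ⟨y, hy⟩

/-! ### Generating systems and amalgamation of bounds -/

/-- A normed space `Y` generated by countably many vectors `e j` and a family `f γ` which behaves
like the unit vector basis of `c₀(Γ)` modulo the span of the `e j`, together with a sequence of
functionals that is weak-star dense in the dual unit ball. -/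
structure CZeroSystem (Y : Type v) [NormedAddCommGroup Y] [NormedSpace ℝ Y] (J Γ : Type u) where
  /-- the vectors spanning the separable part -/
  e : J → Y
  /-- the vectors that are a `c₀(Γ)`-basis modulo the separable part -/
  f : Γ → Y
  /-- the functionals biorthogonal to `f` -/
  g : Γ → StrongDual ℝ Y
  /-- a bound for the biorthogonal functionals -/
  B : ℝ
  g_norm_le : ∀ γ, ‖g γ‖ ≤ B
  g_e : ∀ γ j, g γ (e j) = 0
  g_f_self : ∀ γ, g γ (f γ) = 1
  g_f_ne : ∀ γ δ, γ ≠ δ → g γ (f δ) = 0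
  -- Finiteness of `S` allows an absorbing set to be part of a condition.
  exists_absorbing : ∀ A : Finset Γ, ∃ S : Finset J, ∀ c : Γ → ℝ, (∀ γ, |c γ| ≤ 1) →
    ∃ y ∈ Submodule.span ℝ (e '' S), ‖∑ γ ∈ A, c γ • f γ - y‖ ≤ 2
  /-- the weak-star dense sequence -/
  m : ℕ → StrongDual ℝ Y
  m_norm_le : ∀ n, ‖m n‖ ≤ 1
  m_dense : ∀ ν : StrongDual ℝ Y, ‖ν‖ ≤ 1 → ∀ F : Set Y, F.Finite → ∀ ε > 0,
    ∃ n, ∀ y ∈ F, |m n y - ν y| < ε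

namespace CZeroSystem

variable {Y : Type v} [NormedAddCommGroup Y] [NormedSpace ℝ Y] {J Γ : Type u}

/-- `S` absorbs `A` if all combinations of the `f γ`, `γ ∈ A`, with coefficients in `[-1, 1]` are
at distance at most `2` from the span of the `e j`, `j ∈ S`. -/
def Absorbing (Φ : CZeroSystem Y J Γ) (S : Finset J) (A : Finset Γ) : Prop :=
  ∀ c : Γ → ℝ, (∀ γ, |c γ| ≤ 1) →
    ∃ y ∈ Submodule.span ℝ (Φ.e '' S), ‖∑ γ ∈ A, c γ • Φ.f γ - y‖ ≤ 2

/-- The generators with indices in `S` and `A`. -/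
def gens (Φ : CZeroSystem Y J Γ) (S : Finset J) (A : Finset Γ) : Set Y :=
  Φ.e '' S ∪ Φ.f '' A

/-- The span of the generators with indices in `S` and `A`. -/
def space (Φ : CZeroSystem Y J Γ) (S : Finset J) (A : Finset Γ) : Submodule ℝ Y :=
  Submodule.span ℝ (Φ.gens S A)

theorem finite_gens (Φ : CZeroSystem Y J Γ) (S : Finset J) (A : Finset Γ) :
    (Φ.gens S A).Finite :=
  (S.finite_toSet.image _).union (A.finite_toSet.image _)

theorem gens_mono (Φ : CZeroSystem Y J Γ) {S S' : Finset J} {A A' : Finset Γ} (hS : S ⊆ S')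
    (hA : A ⊆ A') : Φ.gens S A ⊆ Φ.gens S' A' :=
  Set.union_subset_union (Set.image_mono (by exact_mod_cast hS))
    (Set.image_mono (by exact_mod_cast hA))

theorem e_mem_gens (Φ : CZeroSystem Y J Γ) {S : Finset J} (A : Finset Γ) {j : J} (hj : j ∈ S) :
    Φ.e j ∈ Φ.gens S A :=
  Or.inl ⟨j, hj, rfl⟩

theorem f_mem_gens (Φ : CZeroSystem Y J Γ) (S : Finset J) {A : Finset Γ} {γ : Γ} (hγ : γ ∈ A) :
    Φ.f γ ∈ Φ.gens S A :=
  Or.inr ⟨γ, hγ, rfl⟩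

theorem gens_subset_space (Φ : CZeroSystem Y J Γ) (S : Finset J) (A : Finset Γ) :
    Φ.gens S A ⊆ Φ.space S A :=
  Submodule.subset_span

theorem Absorbing.mono {Φ : CZeroSystem Y J Γ} {S S' : Finset J} {A : Finset Γ}
    (h : Φ.Absorbing S A) (hS : S ⊆ S') : Φ.Absorbing S' A := fun c hc =>
  let ⟨y, hy, hle⟩ := h c hc
  ⟨y, Submodule.span_mono (Set.image_mono (by exact_mod_cast hS)) hy, hle⟩

/-- Hahn-Banach followed by weak-star density, rescaled by `D`. It lets the forcing choose natural
numbers instead of functionals, so that only countably many initial segments occur. -/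
theorem exists_seq_approx (Φ : CZeroSystem Y J Γ) (S : Finset J) (A : Finset Γ)
    (φ : Y →ₗ[ℝ] ℝ) {D : ℝ} (hD : 0 < D) (h : ∀ y ∈ Φ.space S A, |φ y| ≤ D * ‖y‖) {ε : ℝ}
    (hε : 0 < ε) : ∃ n, ∀ y ∈ Φ.gens S A, |D * Φ.m n y - φ y| ≤ ε := by
  obtain ⟨ν, hν, hφ⟩ := exists_dual_eq_on_of_bound _ φ hD.le h
  obtain ⟨n, hn⟩ := Φ.m_dense (D⁻¹ • ν)
    (by rw [norm_smul, Real.norm_of_nonneg (by positivity)]; field_simp; exact hν)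
    _ (Φ.finite_gens S A) (ε / D) (by positivity)
  refine ⟨n, fun y hy => ?_⟩
  have h1 := hn y hy
  rw [← hφ y (Φ.gens_subset_space S A hy)]
  have : D * Φ.m n y - ν y = D * (Φ.m n y - (D⁻¹ • ν) y) := by
    simp only [FunLike.coe_smul, Pi.smul_apply, smul_eq_mul]; field_simp
  rw [this, abs_mul, abs_of_pos hD]
  calc D * _ ≤ D * (ε / D) := by gcongr
    _ = ε := by field_simp

open Classical in
-- Modulo the span of the `e j`, sign combinations of the `f γ` have norm at most `2`, and `ν` does
-- not see that span; duality between `c₀` and `ℓ₁` gives the estimate.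
theorem sum_abs_le_of_absorbing (Φ : CZeroSystem Y J Γ) {S : Finset J} {A E : Finset Γ}
    (hS : Φ.Absorbing S A) (hE : E ⊆ A) (ν : StrongDual ℝ Y) (hν : ∀ j ∈ S, ν (Φ.e j) = 0) :
    ∑ γ ∈ E, |ν (Φ.f γ)| ≤ 2 * ‖ν‖ := by
  obtain ⟨y, hy, hle⟩ := hS (fun γ => if γ ∈ E then SignType.sign (ν (Φ.f γ)) else 0) (by
    intro γ
    split_ifs
    · cases SignType.sign (ν (Φ.f γ)) <;> simp
    · simp)
  have hy0 : ν y = 0 := by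
    have : Submodule.span ℝ (Φ.e '' S) ≤ LinearMap.ker ν.toLinearMap := by
      rw [Submodule.span_le]
      rintro _ ⟨j, hj, rfl⟩
      exact hν j hj
    exact this hy
  have hsum : ν (∑ γ ∈ A, (if γ ∈ E then (SignType.sign (ν (Φ.f γ)) : ℝ) else 0) • Φ.f γ - y) =
      ∑ γ ∈ E, |ν (Φ.f γ)| := by
    simp only [map_sub, hy0, sub_zero, map_sum, map_smul, smul_eq_mul, ite_mul, zero_mul]
    rw [Finset.sum_ite_mem, Finset.inter_eq_right.2 hE]
    exact Finset.sum_congr rfl fun γ _ => by rw [sign_mul_self]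
  rw [← hsum]
  calc _ ≤ ‖ν _‖ := Real.le_norm_self _
    _ ≤ ‖ν‖ * _ := ν.le_opNorm _
    _ ≤ ‖ν‖ * 2 := by gcongr
    _ = _ := mul_comm _ _

open Classical in
/-- Bounds on two finitely generated subspaces with the same separable part amalgamate, at the
cost of a constant depending only on the system. -/
theorem bound_union (Φ : CZeroSystem Y J Γ) {S : Finset J} {A A' : Finset Γ}
    (hS : Φ.Absorbing S A') (φ : Y →ₗ[ℝ] ℝ) {C : ℝ} (hC : 0 ≤ C)
    (h : ∀ y ∈ Φ.space S A, |φ y| ≤ C * ‖y‖) (h' : ∀ y ∈ Φ.space S A', |φ y| ≤ C * ‖y‖) :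
    ∀ y ∈ Φ.space S (A ∪ A'), |φ y| ≤ (C + 4 * C * |Φ.B|) * ‖y‖ := by
  obtain ⟨ν, hν, hφ⟩ := exists_dual_eq_on_of_bound _ φ hC h
  obtain ⟨ν', hν', hφ'⟩ := exists_dual_eq_on_of_bound _ φ hC h'
  have hsum := Φ.sum_abs_le_of_absorbing hS (E := A' \ A) Finset.sdiff_subset (ν' - ν) (by
    intro j hj
    rw [FunLike.coe_sub, Pi.sub_apply,
      hφ _ (Φ.gens_subset_space _ _ (Φ.e_mem_gens A hj)),
      hφ' _ (Φ.gens_subset_space _ _ (Φ.e_mem_gens A' hj)), sub_self])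
  have hsub : ‖ν' - ν‖ ≤ C + C := (norm_sub_le _ _).trans (add_le_add hν' hν)
  -- By biorthogonality, adding `ρ` to `ν` changes only its values at `f γ`, `γ ∈ A' \ A`, into
  -- those of `ν'`. Thus `ν + ρ` agrees with `φ` on all generators; the `ℓ₁` estimate `2 * (C + C)`
  -- makes the norm of `ρ` independent of the size of `A' \ A`.
  set ρ : StrongDual ℝ Y := ∑ γ ∈ A' \ A, (ν' - ν) (Φ.f γ) • Φ.g γ with hρ
  have hρn : ‖ρ‖ ≤ 4 * C * |Φ.B| := by
    calc ‖ρ‖ ≤ ∑ γ ∈ A' \ A, |(ν' - ν) (Φ.f γ)| * |Φ.B| := by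
          refine norm_sum_le_of_le _ fun γ _ => ?_
          rw [norm_smul]
          exact mul_le_mul_of_nonneg_left ((Φ.g_norm_le γ).trans (le_abs_self _)) (norm_nonneg _)
      _ = (∑ γ ∈ A' \ A, |(ν' - ν) (Φ.f γ)|) * |Φ.B| := by rw [Finset.sum_mul]
      _ ≤ (4 * C) * |Φ.B| := by gcongr; linarith
  have hρe : ∀ j, ρ (Φ.e j) = 0 := fun j => by simp [hρ, Φ.g_e]
  have hρf : ∀ δ, ρ (Φ.f δ) = if δ ∈ A' \ A then (ν' - ν) (Φ.f δ) else 0 := fun δ => by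
    have : ∀ γ, (Φ.g γ) (Φ.f δ) = if δ = γ then 1 else 0 := fun γ => by
      split_ifs with hγ
      · rw [hγ, Φ.g_f_self]
      · exact Φ.g_f_ne _ _ (Ne.symm hγ)
    rw [hρ]
    simp only [FunLike.coe_sum, Finset.sum_apply, FunLike.coe_smul,
      Pi.smul_apply, this, smul_eq_mul, mul_ite, mul_one, mul_zero, Finset.sum_ite_eq]
  have heq : Set.EqOn φ (ν + ρ).toLinearMap (Φ.space S (A ∪ A')) := by
    refine LinearMap.eqOn_span ?_
    rintro _ (⟨j, hj, rfl⟩ | ⟨γ, hγ, rfl⟩)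
    · simp [hρe, hφ _ (Φ.gens_subset_space _ _ (Φ.e_mem_gens A hj))]
    · by_cases hA : γ ∈ A
      · simp [hρf, hA, hφ _ (Φ.gens_subset_space _ _ (Φ.f_mem_gens S hA))]
      · have hA' : γ ∈ A' := by
          have := Finset.mem_union.1 (Finset.mem_coe.1 hγ)
          tauto
        simp [hρf, hA, hA', hφ' _ (Φ.gens_subset_space _ _ (Φ.f_mem_gens S hA'))]
  intro y hy
  rw [heq hy]
  exact ((ν + ρ).le_opNorm y).trans (by
    gcongr
    exact (norm_add_le _ _).trans (add_le_add hν hρn))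

/-! ### The forcing notion and its chain condition -/

/-- The conditions of the forcing notion: finite approximations `σ` to a sequence of functionals,
with a finite set of generators on which the sequence is promised to follow `t`. -/
@[ext]
structure Condition (Φ : CZeroSystem Y J Γ) (t : ℕ → Y →ₗ[ℝ] ℝ) (C : ℝ) where
  /-- the length of the approximation -/
  n : ℕ
  /-- the indices of the functionals chosen so far -/
  σ : ℕ → ℕ
  /-- the indices of the promised generators in the separable part -/
  S : Finset J
  /-- the indices of the other promised generators -/
  A : Finset Γ
  σ_eq_zero : ∀ k, n ≤ k → σ k = 0
  absorbing : Φ.Absorbing S A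
  bound : ∀ k, n ≤ k → ∀ y ∈ Φ.space S A, |t k y| ≤ C * ‖y‖

variable {Φ : CZeroSystem Y J Γ} {t : ℕ → Y →ₗ[ℝ] ℝ} {C : ℝ}

/-- The constant bounding the norms of the functionals that are used in the construction. -/
def bigBound (Φ : CZeroSystem Y J Γ) (C : ℝ) : ℝ := C + 4 * C * |Φ.B|

/-- The functional with index `i` is close to `t k` on the generators in `S` and `A`. -/
def Follows (Φ : CZeroSystem Y J Γ) (t : ℕ → Y →ₗ[ℝ] ℝ) (C : ℝ) (S : Finset J) (A : Finset Γ)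
    (k i : ℕ) : Prop :=
  ∀ y ∈ Φ.gens S A, |Φ.bigBound C * Φ.m i y - t k y| ≤ 1 / ((k : ℝ) + 1)

theorem Follows.mono {S S' : Finset J} {A A' : Finset Γ} {k i : ℕ}
    (h : Φ.Follows t C S' A' k i) (hS : S ⊆ S') (hA : A ⊆ A') : Φ.Follows t C S A k i :=
  fun y hy => h y (Φ.gens_mono hS hA hy)

instance : PartialOrder (Condition Φ t C) where
  le p q := p.n ≤ q.n ∧ (∀ k < p.n, q.σ k = p.σ k) ∧ p.S ⊆ q.S ∧ p.A ⊆ q.A ∧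
    ∀ k, p.n ≤ k → k < q.n → Φ.Follows t C p.S p.A k (q.σ k)
  le_refl p := ⟨le_rfl, fun _ _ => rfl, subset_rfl, subset_rfl, fun k h h' => by omega⟩
  le_trans p q r := by
    rintro ⟨hn, hσ, hS, hA, hf⟩ ⟨hn', hσ', hS', hA', hf'⟩
    refine ⟨hn.trans hn', fun k hk => ?_, hS.trans hS', hA.trans hA', fun k hk hk' => ?_⟩
    · rw [hσ' k (by omega), hσ k hk]
    · rcases lt_or_ge k q.n with h | h
      · rw [hσ' k h]
        exact hf k hk h
      · exact (hf' k h hk').mono hS hA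
  le_antisymm p q := by
    rintro ⟨hn, hσ, hS, hA, hf⟩ ⟨hn', hσ', hS', hA', hf'⟩
    refine Condition.ext (le_antisymm hn hn') (funext fun k => ?_) (hS.antisymm hS')
      (hA.antisymm hA')
    rcases lt_or_ge k p.n with h | h
    · exact (hσ k h).symm
    -- The default value `0` beyond the length is what makes the order antisymmetric.
    · rw [p.σ_eq_zero k h, q.σ_eq_zero k (hn'.trans h)]

open Classical in
-- The weaker bound `bigBound` already permits choosing further terms that follow `t` on `S` and
-- `A`. Adding terms until the bound `C` holds on the enlarged span produces a genuine condition
-- again, so the constant does not grow under iteration.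
theorem Condition.exists_extension (hC : 0 < C)
    (ht : ∀ S A, ∃ N, ∀ k, N ≤ k → ∀ y ∈ Φ.space S A, |t k y| ≤ C * ‖y‖)
    (n : ℕ) (σ : ℕ → ℕ) (S : Finset J) (A : Finset Γ)
    (h : ∀ k, n ≤ k → ∀ y ∈ Φ.space S A, |t k y| ≤ Φ.bigBound C * ‖y‖)
    (n' : ℕ) (S' : Finset J) (A' : Finset Γ) :
    ∃ r : Condition Φ t C, n ≤ r.n ∧ n' ≤ r.n ∧ (∀ k < n, r.σ k = σ k) ∧ S ⊆ r.S ∧ S' ⊆ r.S ∧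
      A ⊆ r.A ∧ A' ⊆ r.A ∧ ∀ k, n ≤ k → k < r.n → Φ.Follows t C S A k (r.σ k) := by
  have hD : 0 < Φ.bigBound C := by unfold bigBound; positivity
  have hex : ∀ k, ∃ i, n ≤ k → Φ.Follows t C S A k i := fun k => by
    by_cases hk : n ≤ k
    · obtain ⟨i, hi⟩ := Φ.exists_seq_approx S A (t k) hD (h k hk)
        (Nat.one_div_pos_of_nat (α := ℝ) (n := k))
      exact ⟨i, fun _ => hi⟩
    · exact ⟨0, fun h => absurd h hk⟩
  choose τ hτ using hex
  obtain ⟨S₀, hS₀⟩ := Φ.exists_absorbing (A ∪ A')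
  -- `S₀` makes the new promise absorbing; from `N` on, the bound `C` holds on the new span.
  obtain ⟨N, hN⟩ := ht (S ∪ S' ∪ S₀) (A ∪ A')
  refine ⟨⟨max N (max n n'), fun k => if k < n then σ k else if k < max N (max n n') then τ k
    else 0, S ∪ S' ∪ S₀, A ∪ A', fun k hk => ?_, Absorbing.mono hS₀ Finset.subset_union_right,
    fun k hk => hN k (by omega)⟩, by simp, by simp, fun k hk => if_pos hk, ?_, ?_,
    Finset.subset_union_left, Finset.subset_union_right, fun k hk hk' => ?_⟩
  · rw [if_neg (by omega), if_neg (by omega)]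
  · exact Finset.subset_union_left.trans Finset.subset_union_left
  · exact Finset.subset_union_right.trans Finset.subset_union_left
  · have : ¬ k < n := by omega
    simpa only [if_neg this, if_pos hk'] using hτ k hk

theorem le_bigBound (Φ : CZeroSystem Y J Γ) (hC : 0 < C) : C ≤ Φ.bigBound C :=
  le_add_of_nonneg_right (by positivity)

theorem Condition.exists_ge (hC : 0 < C)
    (ht : ∀ S A, ∃ N, ∀ k, N ≤ k → ∀ y ∈ Φ.space S A, |t k y| ≤ C * ‖y‖)
    (p : Condition Φ t C) (n' : ℕ) (S' : Finset J) (A' : Finset Γ) :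
    ∃ r : Condition Φ t C, p ≤ r ∧ n' ≤ r.n ∧ S' ⊆ r.S ∧ A' ⊆ r.A := by
  obtain ⟨r, h₁, h₂, h₃, h₄, h₅, h₆, h₇, h₈⟩ := exists_extension hC ht p.n p.σ p.S p.A
    (fun k hk y hy => (p.bound k hk y hy).trans (by gcongr; exact Φ.le_bigBound hC)) n' S' A'
  exact ⟨r, ⟨h₁, h₃, h₄, h₆, h₈⟩, h₂, h₅, h₇⟩

open Classical in
-- `bound_union` gives the bound `bigBound` on the span of the joint promises, which is exactly what
-- `exists_extension` accepts.
theorem Condition.exists_common_ge (hC : 0 < C)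
    (ht : ∀ S A, ∃ N, ∀ k, N ≤ k → ∀ y ∈ Φ.space S A, |t k y| ≤ C * ‖y‖)
    (p q : Condition Φ t C) (hn : p.n = q.n) (hσ : ∀ k < p.n, p.σ k = q.σ k) (hS : p.S = q.S) :
    ∃ r, p ≤ r ∧ q ≤ r := by
  obtain ⟨r, h₁, h₂, h₃, h₄, h₅, h₆, h₇, h₈⟩ := exists_extension hC ht p.n p.σ p.S (p.A ∪ q.A)
    (fun k hk => Φ.bound_union (hS ▸ q.absorbing) (t k) hC.le (p.bound k hk)
      (hS ▸ q.bound k (hn ▸ hk))) 0 ∅ ∅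
  refine ⟨r, ⟨h₁, h₃, h₄, Finset.subset_union_left.trans h₆,
    fun k hk hk' => (h₈ k hk hk').mono subset_rfl Finset.subset_union_left⟩,
    ⟨hn ▸ h₁, fun k hk => ?_, hS ▸ h₄, Finset.subset_union_right.trans h₆,
    fun k hk hk' => (h₈ k (hn ▸ hk) hk').mono hS.ge Finset.subset_union_right⟩⟩
  rw [h₃ k (hn ▸ hk), hσ k (hn ▸ hk)]

theorem Condition.satisfiesCCC [Countable J] (hC : 0 < C)
    (ht : ∀ S A, ∃ N, ∀ k, N ≤ k → ∀ y ∈ Φ.space S A, |t k y| ≤ C * ‖y‖) :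
    SatisfiesCCC (Condition Φ t C) := by
  intro 𝒜 h𝒜
  -- The code omits only `A` and takes countably many values, so two distinct members of `𝒜` share a
  -- code.
  let code : Condition Φ t C → (Σ n : ℕ, (Fin n → ℕ)) × Finset J :=
    fun p => (⟨p.n, fun k => p.σ k⟩, p.S)
  have hni : ¬ Set.InjOn code 𝒜 := fun hinj =>
    h𝒜 (Set.MapsTo.countable_of_injOn (Set.mapsTo_univ _ _) hinj Set.countable_univ)
  simp only [Set.InjOn, not_forall] at hni
  obtain ⟨p, hp, q, hq, hpq, hne⟩ := hni
  refine ⟨p, hp, q, hq, hne, ?_⟩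
  obtain ⟨n, σ, S, A, h₁, h₂, h₃⟩ := p
  obtain ⟨n', σ', S', A', h₁', h₂', h₃'⟩ := q
  simp only [code, Prod.mk.injEq, Sigma.mk.injEq] at hpq
  obtain ⟨⟨rfl, hσ⟩, rfl⟩ := hpq
  exact exists_common_ge hC ht _ _ rfl (fun k hk => congrFun (eq_of_heq hσ) ⟨k, hk⟩) rfl

end CZeroSystem

/-! ### Application of Martin's axiom -/

theorem MartinMA.exists_directedOn {κ : Cardinal.{u}} (hMA : MartinMA κ) {P : Type u}
    [PartialOrder P] [Nonempty P] (hP : SatisfiesCCC P) {ι : Type u} [Nonempty ι] (hι : #ι ≤ κ)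
    (D : ι → Set P) (hD : ∀ ξ, IsCofinal (D ξ)) :
    ∃ G : Set P, DirectedOn (· ≤ ·) G ∧ ∀ ξ, (G ∩ D ξ).Nonempty := by
  rw [← κ.mk_out, Cardinal.le_def] at hι
  obtain ⟨j⟩ := hι
  -- Families smaller than `κ` are padded by repetition, along a left inverse of an embedding into
  -- `κ`.
  obtain ⟨G, hG, h⟩ := hMA P hP κ.out κ.mk_out (fun x => D (Function.invFun j x)) fun _ => hD _
  refine ⟨G, hG, fun ξ => ?_⟩
  simpa [Function.leftInverse_invFun j.injective ξ] using h (j ξ)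

namespace CZeroSystem

variable {Y : Type v} [NormedAddCommGroup Y] [NormedSpace ℝ Y] {J Γ : Type u}

theorem exists_bounded_asymptotic {κ : Cardinal.{u}} (hMA : MartinMA κ) (hκ : ℵ₀ ≤ κ)
    (hΓ : #Γ ≤ κ) [Countable J] (Φ : CZeroSystem Y J Γ) (t : ℕ → Y →ₗ[ℝ] ℝ) {C : ℝ} (hC : 0 < C)
    (ht : ∀ S A, ∃ N, ∀ k, N ≤ k → ∀ y ∈ Φ.space S A, |t k y| ≤ C * ‖y‖) :
    ∃ (D : ℝ) (μ : ℕ → StrongDual ℝ Y), (∀ k, ‖μ k‖ ≤ D) ∧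
      (∀ j, Tendsto (fun k => μ k (Φ.e j) - t k (Φ.e j)) atTop (𝓝 0)) ∧
      (∀ γ, Tendsto (fun k => μ k (Φ.f γ) - t k (Φ.f γ)) atTop (𝓝 0)) := by
  have hD : 0 < Φ.bigBound C := hC.trans_le (Φ.le_bigBound hC)
  have : Nonempty (Condition Φ t C) := by
    obtain ⟨N, hN⟩ := ht ∅ ∅
    exact ⟨⟨N, 0, ∅, ∅, fun _ _ => rfl, fun c _ => ⟨0, Submodule.zero_mem _, by simp⟩, hN⟩⟩
  let 𝒟 : ULift.{u} ℕ ⊕ J ⊕ Γ → Set (Condition Φ t C) := fun ξ => match ξ with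
    | .inl n => {p | n.down ≤ p.n}
    | .inr (.inl j) => {p | j ∈ p.S}
    | .inr (.inr γ) => {p | γ ∈ p.A}
  obtain ⟨G, hG, hGD⟩ := hMA.exists_directedOn (Condition.satisfiesCCC hC ht)
    (ι := ULift.{u} ℕ ⊕ J ⊕ Γ) (by
      simp only [Cardinal.mk_sum, Cardinal.lift_id, Cardinal.mk_uLift, Cardinal.mk_nat,
        Cardinal.lift_aleph0]
      exact Cardinal.add_le_of_le hκ hκ (Cardinal.add_le_of_le hκ
        ((Cardinal.mk_le_aleph0_iff.2 inferInstance).trans hκ) hΓ)) 𝒟 (by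
    rintro (n | j | γ) p
    · obtain ⟨r, hr, h, -⟩ := Condition.exists_ge hC ht p n.down ∅ ∅
      exact ⟨r, h, hr⟩
    · obtain ⟨r, hr, -, h, -⟩ := Condition.exists_ge hC ht p 0 {j} ∅
      exact ⟨r, Finset.singleton_subset_iff.1 h, hr⟩
    · obtain ⟨r, hr, -, -, h⟩ := Condition.exists_ge hC ht p 0 ∅ {γ}
      exact ⟨r, Finset.singleton_subset_iff.1 h, hr⟩)
  have hlen : ∀ k, ∃ p ∈ G, k < p.n := fun k =>
    let ⟨p, hp, h⟩ := hGD (.inl ⟨k + 1⟩)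
    ⟨p, hp, h⟩
  choose p hpG hp using hlen
  -- A common upper bound of `q` and `p k` has the same `k`-th term as `p k`, and this term keeps
  -- the promise of `q`.
  have hfollow : ∀ q ∈ G, ∀ k, q.n ≤ k → Φ.Follows t C q.S q.A k ((p k).σ k) := by
    intro q hq k hk
    obtain ⟨r, -, hqr, hpr⟩ := hG q hq (p k) (hpG k)
    rw [← hpr.2.1 k (hp k)]
    exact hqr.2.2.2.2 k hk ((hp k).trans_le hpr.1)
  have htend : ∀ q ∈ G, ∀ y ∈ Φ.gens q.S q.A,
      Tendsto (fun k => (Φ.bigBound C • Φ.m ((p k).σ k)) y - t k y) atTop (𝓝 0) := by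
    intro q hq y hy
    refine squeeze_zero_norm' ?_ tendsto_one_div_add_atTop_nhds_zero_nat
    filter_upwards [eventually_ge_atTop q.n] with k hk
    exact hfollow q hq k hk y hy
  refine ⟨Φ.bigBound C, fun k => Φ.bigBound C • Φ.m ((p k).σ k), fun k => ?_, fun j => ?_,
    fun γ => ?_⟩
  · rw [norm_smul, Real.norm_of_nonneg hD.le]
    exact mul_le_of_le_one_right hD.le (Φ.m_norm_le _)
  · obtain ⟨q, hq, hj⟩ := hGD (.inr (.inl j))
    exact htend q hq _ (Φ.e_mem_gens _ hj)
  · obtain ⟨q, hq, hγ⟩ := hGD (.inr (.inr γ))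
    exact htend q hq _ (Φ.f_mem_gens _ hγ)

end CZeroSystem

/-! ### Isolated points of closed sets and peak functions -/

section Peaks

variable {K : Type u} [TopologicalSpace K]

theorem notMem_derivedSet_iff {D : Set K} {x : K} : x ∉ derivedSet D ↔ x ∉ closure (D \ {x}) := by
  rw [mem_derivedSet, accPt_principal_iff_clusterPt, mem_closure_iff_clusterPt]

theorem derivedSet_subset_of_isClosed {D : Set K} (hD : IsClosed D) : derivedSet D ⊆ D :=
  (isClosed_iff_derivedSet_subset D).1 hD

theorem isClosed_sdiff_singleton {D : Set K} (hD : IsClosed D) {x : K} (hx : x ∉ derivedSet D) :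
    IsClosed (D \ {x}) := by
  refine isClosed_of_closure_subset fun y hy => ⟨hD.closure_subset_iff.2 Set.sdiff_subset hy, ?_⟩
  rintro rfl
  exact notMem_derivedSet_iff.1 hx hy

theorem finite_of_disjoint_derivedSet [CompactSpace K] {D T : Set K} (hT : IsClosed T)
    (hTD : T ⊆ D) (h : ∀ x ∈ T, x ∉ derivedSet D) : T.Finite := by
  by_contra hinf
  obtain ⟨x, hx, hacc⟩ := Set.Infinite.exists_accPt_of_subset_isCompact hinf hT.isCompact subset_rfl
  exact h x hx (derivedSet_mono _ _ hTD hacc)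

theorem derivedSet_eq_empty_of_finite [T1Space K] {D : Set K} (hD : D.Finite) :
    derivedSet D = ∅ := by
  refine Set.eq_empty_of_forall_notMem fun x => notMem_derivedSet_iff.2 ?_
  rw [(hD.subset Set.sdiff_subset).isClosed.closure_eq]
  simp

/-- A family of continuous functions with values in `[0, 1]`, indexed by the isolated points of a
closed set `D`, and restricting on `D` to the indicator functions of these points. -/
structure IsPeakFamily (D : Set K) (p : ↥(D \ derivedSet D) → C(K, ℝ)) : Prop where
  self : ∀ d : ↥(D \ derivedSet D), p d d = 1
  ne : ∀ d : ↥(D \ derivedSet D), ∀ x ∈ D, x ≠ d → p d x = 0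
  nonneg : ∀ d x, 0 ≤ p d x
  le_one : ∀ d x, p d x ≤ 1

theorem exists_isPeakFamily [NormalSpace K] [T1Space K] {D : Set K} (hD : IsClosed D) :
    ∃ p, IsPeakFamily D p := by
  have h : ∀ d : ↥(D \ derivedSet D), ∃ f : C(K, ℝ), f d = 1 ∧ (∀ x ∈ D, x ≠ d → f x = 0) ∧
      ∀ x, 0 ≤ f x ∧ f x ≤ 1 := fun d => by
    obtain ⟨f, hf0, hf1, hf⟩ := exists_continuous_zero_one_of_isClosed
      (isClosed_sdiff_singleton hD d.2.2) (isClosed_singleton (x := (d : K))) (by simp)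
    exact ⟨f, hf1 rfl, fun x hx hne => hf0 ⟨hx, hne⟩, hf⟩
  choose p h1 h2 h3 using h
  exact ⟨p, h1, h2, fun d x => (h3 d x).1, fun d x => (h3 d x).2⟩

namespace IsPeakFamily

variable {D : Set K} {p : ↥(D \ derivedSet D) → C(K, ℝ)}

theorem sum_apply_of_mem (hp : IsPeakFamily D p) (c : ↥(D \ derivedSet D) → ℝ)
    {T : Finset ↥(D \ derivedSet D)} {d : ↥(D \ derivedSet D)} (hd : d ∈ T) :
    (∑ d ∈ T, c d • p d) d = c d := by
  rw [ContinuousMap.sum_apply, Finset.sum_eq_single d]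
  · simp [hp.self]
  · intro d' _ hne
    simp [hp.ne d' d d.2.1 fun h => hne (Subtype.ext h.symm)]
  · exact fun h => absurd hd h

theorem sum_apply_of_notMem (hp : IsPeakFamily D p) (c : ↥(D \ derivedSet D) → ℝ)
    {T : Finset ↥(D \ derivedSet D)} {x : K} (hx : x ∈ D) (hT : ∀ d ∈ T, x ≠ d) :
    (∑ d ∈ T, c d • p d) x = 0 := by
  rw [ContinuousMap.sum_apply]
  exact Finset.sum_eq_zero fun d hd => by simp [hp.ne d x hx (hT d hd)]

/-- By compactness `T` is finite, as an accumulation point would lie in `T ∩ derivedSet D`. Hence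
`S` depends on `T` alone and serves all `g`. -/
theorem exists_interpolation [CompactSpace K] (hp : IsPeakFamily D p) {T : Set K}
    (hT : IsClosed T) (hTD : T ⊆ D) (h : ∀ x ∈ T, x ∉ derivedSet D) :
    ∃ S : Finset ↥(D \ derivedSet D), ∀ g : C(K, ℝ), ∃ w ∈ Submodule.span ℝ (p '' S),
      (∀ x ∈ T, w x = g x) ∧ ∀ x ∈ D, x ∉ T → w x = 0 := by
  have hfin : {d : ↥(D \ derivedSet D) | (d : K) ∈ T}.Finite :=
    Set.Finite.preimage Subtype.val_injective.injOn (finite_of_disjoint_derivedSet hT hTD h)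
  refine ⟨hfin.toFinset, fun g => ⟨∑ d ∈ hfin.toFinset, g d • p d, ?_, fun x hx => ?_,
    fun x hx hxT => ?_⟩⟩
  · exact Submodule.sum_mem _ fun d hd => Submodule.smul_mem _ _ (Submodule.subset_span ⟨d, hd, rfl⟩)
  · exact hp.sum_apply_of_mem (fun d => g d) (d := ⟨x, hTD hx, h x hx⟩) (by simpa using hx)
  · refine hp.sum_apply_of_notMem _ hx fun d hd => ?_
    rintro rfl
    exact hxT (by simpa using hd)

/-- Only finitely many points of `D` have `|g x| ≥ ε`, all isolated in `D`; interpolating `g` there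
suffices. -/
theorem exists_approx [CompactSpace K] (hp : IsPeakFamily D p) (hD : IsClosed D) (g : C(K, ℝ))
    {ε : ℝ} (hε : 0 < ε) (hg : ∀ x ∈ derivedSet D, |g x| < ε) :
    ∃ w ∈ Submodule.span ℝ (Set.range p), ∀ x ∈ D, |g x - w x| < ε := by
  have hcl : IsClosed (D ∩ {x | ε ≤ |g x|}) :=
    hD.inter (isClosed_le continuous_const g.continuous.abs)
  obtain ⟨S, hS⟩ := hp.exists_interpolation hcl Set.inter_subset_left
    fun x hx hx' => (hg x hx').not_ge hx.2
  obtain ⟨w, hw, h1, h2⟩ := hS g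
  refine ⟨w, Submodule.span_mono (Set.image_subset_range _ _) hw, fun x hx => ?_⟩
  by_cases hxT : ε ≤ |g x|
  · rwa [h1 x ⟨hx, hxT⟩, sub_self, abs_zero]
  · rw [h2 x hx fun h => hxT h.2, sub_zero]
    exact not_le.1 hxT

theorem sum_le_one (hp : IsPeakFamily D p) (A : Finset ↥(D \ derivedSet D)) {x : K} (hx : x ∈ D) :
    (∑ d ∈ A, p d) x ≤ 1 := by
  have h : ∑ d ∈ A, p d = ∑ d ∈ A, (fun _ => (1 : ℝ)) d • p d := by simp
  by_cases hA : ∀ d ∈ A, x ≠ d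
  · rw [h, hp.sum_apply_of_notMem _ hx hA]
    exact zero_le_one
  · push Not at hA
    obtain ⟨d, hd, rfl⟩ := hA
    rw [h, hp.sum_apply_of_mem _ hd]

end IsPeakFamily

theorem countable_isolated [TopologicalSpace.SeparableSpace K] :
    (Set.univ \ derivedSet (Set.univ : Set K)).Countable := by
  obtain ⟨s, hs, hd⟩ := TopologicalSpace.exists_countable_dense K
  refine hs.mono fun x hx => ?_
  have hopen : IsOpen ({x} : Set K) := by
    rw [← isClosed_compl_iff, Set.compl_eq_univ_sdiff]
    exact isClosed_sdiff_singleton isClosed_univ hx.2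
  obtain ⟨y, rfl, hy⟩ := hd.inter_open_nonempty _ hopen ⟨x, rfl⟩
  exact hy

/-- The number of isolated points of a closed subset is at most the weight of the space. -/
theorem mk_isolated_le_topWeight {D : Set K} (hD : IsClosed D) :
    #↥(D \ derivedSet D) ≤ topWeight K := by
  have hne : {c | ∃ B : Set (Set K), TopologicalSpace.IsTopologicalBasis B ∧ #B = c}.Nonempty :=
    ⟨_, _, TopologicalSpace.isTopologicalBasis_opens, rfl⟩
  obtain ⟨B, hB, hcard⟩ := csInf_mem hne
  rw [topWeight, ← hcard]
  -- A basic set meeting `D` only in `d` determines `d`.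
  have h : ∀ d : ↥(D \ derivedSet D), ∃ b ∈ B, (d : K) ∈ b ∧ b ⊆ (D \ {(d : K)})ᶜ := fun d =>
    hB.exists_subset_of_mem_open (by simp) (isClosed_sdiff_singleton hD d.2.2).isOpen_compl
  choose b hbB hdb hb using h
  refine Cardinal.mk_le_of_injective (f := fun d => (⟨b d, hbB d⟩ : B)) fun d d' hdd' => ?_
  have hb' : b d = b d' := congrArg Subtype.val hdd'
  have := hb d' (hb' ▸ hdb d)
  by_contra hne
  exact this ⟨d.2.1, fun h => hne (Subtype.ext h)⟩

end Peaks

/-! ### Weak-star separability of the dual ball -/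

section WeakStarSeparable

/-- If a countable set of functionals is norming, then the dual unit ball is weak-star
separable. -/
theorem exists_weakStar_dense_seq {Y : Type*} [NormedAddCommGroup Y] [NormedSpace ℝ Y]
    {s : Set (StrongDual ℝ Y)} (hs : s.Countable) (hs_le : ∀ ℓ ∈ s, ‖ℓ‖ ≤ 1)
    (hs_norming : ∀ y c, 0 ≤ c → (∀ ℓ ∈ s, |ℓ y| ≤ c) → ‖y‖ ≤ c) :
    ∃ m : ℕ → StrongDual ℝ Y, (∀ n, ‖m n‖ ≤ 1) ∧
      ∀ ν : StrongDual ℝ Y, ‖ν‖ ≤ 1 → ∀ F : Set Y, F.Finite → ∀ ε > 0,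
        ∃ n, ∀ y ∈ F, |m n y - ν y| < ε := by
  let V : Submodule ℝ (StrongDual ℝ Y) := Submodule.span ℝ s
  let W : Set (StrongDual ℝ Y) := V ∩ Metric.closedBall 0 1
  have hW : TopologicalSpace.IsSeparable W :=
    (hs.isSeparable.span (R := ℝ)).mono Set.inter_subset_left
  have hW0 : (0 : StrongDual ℝ Y) ∈ W := ⟨V.zero_mem, by simp⟩
  have hWs : ∀ ℓ ∈ s, ℓ ∈ W ∧ -ℓ ∈ W := fun ℓ hℓ => by
    have h1 : ℓ ∈ V := Submodule.subset_span hℓ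
    have h2 := hs_le ℓ hℓ
    exact ⟨⟨h1, by simpa using h2⟩, ⟨V.neg_mem h1, by simpa using h2⟩⟩
  obtain ⟨Q, hQW, hQc, hQd⟩ := hW.exists_countable_dense_subset
  have hQne : Q.Nonempty := closure_nonempty_iff.1 ⟨0, hQd hW0⟩
  obtain ⟨m, rfl⟩ := hQc.exists_eq_range hQne
  refine ⟨m, fun n => by simpa using (hQW ⟨n, rfl⟩).2, fun ν hν F hF ε hε => ?_⟩
  have := hF.fintype
  let ev : StrongDual ℝ Y →L[ℝ] (F → ℝ) :=
    ContinuousLinearMap.pi fun f => ContinuousLinearMap.apply ℝ ℝ (f : Y)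
  have hclos : ev ν ∈ closure (ev '' W) := by
    by_contra hnot
    have hconv : Convex ℝ (closure (ev '' W)) :=
      ((V.convex.inter (convex_closedBall _ _)).is_linear_image ev.toLinearMap.isLinear).closure
    obtain ⟨φ, c, hφ, hc⟩ := geometric_hahn_banach_closed_point hconv isClosed_closure hnot
    classical
    -- The separating functional is evaluation at `h`. Since `c` bounds `h` on the symmetric norming
    -- set `s`, `‖h‖ ≤ c`, which contradicts `c < ν h` for `ν` in the unit ball.
    let h : Y := ∑ f : F, φ (Pi.single f 1) • (f : Y)
    have hφh : ∀ ℓ, φ (ev ℓ) = ℓ h := fun ℓ => by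
      conv_lhs => rw [pi_eq_sum_univ' (ev ℓ)]
      simp only [map_sum, map_smul, h, smul_eq_mul]
      refine Finset.sum_congr rfl fun f _ => ?_
      rw [mul_comm]
      congr 2
    have hlt : ∀ ℓ ∈ W, ℓ h < c := fun ℓ hℓ =>
      hφh ℓ ▸ hφ _ (subset_closure ⟨ℓ, hℓ, rfl⟩)
    have hc0 : 0 < c := by simpa using hlt 0 hW0
    have hh : ‖h‖ ≤ c := by
      refine hs_norming h c hc0.le fun ℓ hℓ => abs_le.2 ⟨?_, (hlt _ (hWs ℓ hℓ).1).le⟩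
      linarith [show -ℓ h < c from hlt _ (hWs ℓ hℓ).2]
    have : ν h ≤ c := (Real.le_norm_self _).trans ((ν.le_opNorm h).trans
      ((mul_le_of_le_one_left (norm_nonneg _) hν).trans hh))
    rw [hφh] at hc
    exact hc.not_ge this
  have hclos' : ev ν ∈ closure (ev '' Set.range m) :=
    closure_minimal ((Set.image_mono hQd).trans
      (image_closure_subset_closure_image ev.continuous)) isClosed_closure hclos
  obtain ⟨_, ⟨_, ⟨n, rfl⟩, rfl⟩, hn⟩ := Metric.mem_closure_iff.1 hclos' ε hε
  refine ⟨n, fun y hy => ?_⟩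
  rw [dist_comm] at hn
  exact (dist_le_pi_dist (ev (m n)) (ev ν) ⟨y, hy⟩).trans_lt hn

end WeakStarSeparable

/-- The dual of a normed space, topologized by the norm. -/
abbrev NormedDual (Y : Type*) [NormedAddCommGroup Y] [NormedSpace ℝ Y] := StrongDual ℝ Y

section Evaluation

variable {K : Type u} [TopologicalSpace K] [CompactSpace K]

/-- Evaluation at a point as a functional on `C(K)`. -/
noncomputable def evalDual (x : K) : NormedDual C(K, ℝ) :=
  LinearMap.mkContinuous
    { toFun := fun f => f x, map_add' := fun _ _ => rfl, map_smul' := fun _ _ => rfl } 1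
    fun f => by simpa using f.norm_coe_le_norm x

@[simp]
theorem evalDual_apply (x : K) (f : C(K, ℝ)) : evalDual x f = f x := rfl

theorem norm_evalDual_le_one (x : K) : ‖evalDual x‖ ≤ 1 :=
  LinearMap.mkContinuous_norm_le _ zero_le_one _

theorem exists_weakStar_dense_seq_continuousMap [TopologicalSpace.SeparableSpace K] :
    ∃ m : ℕ → NormedDual C(K, ℝ), (∀ n, ‖m n‖ ≤ 1) ∧
      ∀ ν : NormedDual C(K, ℝ), ‖ν‖ ≤ 1 → ∀ F : Set C(K, ℝ), F.Finite → ∀ ε > 0,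
        ∃ n, ∀ y ∈ F, |m n y - ν y| < ε := by
  obtain ⟨s, hs, hd⟩ := TopologicalSpace.exists_countable_dense K
  refine exists_weakStar_dense_seq (hs.image evalDual) ?_ fun y c hc hy => ?_
  · rintro _ ⟨x, -, rfl⟩
    exact norm_evalDual_le_one x
  · rw [ContinuousMap.norm_le _ hc]
    intro x
    have hcl : IsClosed {x | ‖y x‖ ≤ c} := isClosed_le y.continuous.norm continuous_const
    exact closure_minimal (fun x hx => hy _ ⟨x, hx, rfl⟩) hcl (hd x)

end Evaluation

theorem norm_sub_sum_smul_le {Y ι : Type*} [NormedAddCommGroup Y] [NormedSpace ℝ Y] [Fintype ι]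
    {y₀ : Y} {y : ι → Y} {c : ι → ℝ} (h₀ : ‖y₀‖ ≤ 1) (h : ∀ x, ‖y x‖ ≤ 1) (hc₀ : ∀ x, 0 ≤ c x)
    (hc₁ : ∀ x, c x ≤ 1) : ‖y₀ - ∑ x, c x • y x‖ ≤ 1 + Fintype.card ι := by
  refine (norm_sub_le _ _).trans (add_le_add h₀ ?_)
  refine (norm_sum_le_of_le (n := fun _ => 1) _ fun x _ => ?_).trans (by simp)
  rw [norm_smul, Real.norm_of_nonneg (hc₀ x)]
  exact mul_le_one₀ (hc₁ x) (norm_nonneg _) (h x)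

/-! ### The generating system of `C(K)` -/

section System

variable {K : Type u} [TopologicalSpace K] [CompactSpace K] [T2Space K]

/-- The generating system of `C(K)` for a separable compact space of height at most three. -/
theorem exists_cZeroSystem [TopologicalSpace.SeparableSpace K] {K₁ K₂ : Set K}
    (h₁ : derivedSet (Set.univ : Set K) = K₁) (h₂ : derivedSet K₁ = K₂) (h₃ : derivedSet K₂ = ∅) :
    ∃ Φ : CZeroSystem C(K, ℝ)
        (↥(Set.univ \ derivedSet (Set.univ : Set K)) ⊕ ↥(K₂ \ derivedSet K₂))
        ↥(K₁ \ derivedSet K₁),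
      Dense (Submodule.span ℝ (Set.range Φ.e ∪ Set.range Φ.f) : Set C(K, ℝ)) := by
  have hc₁ : IsClosed K₁ := h₁ ▸ isClosed_derivedSet _
  have hc₂ : IsClosed K₂ := h₂ ▸ isClosed_derivedSet _
  have h₂₁ : K₂ ⊆ K₁ := h₂ ▸ derivedSet_subset_of_isClosed hc₁
  obtain ⟨a, ha⟩ := exists_isPeakFamily (isClosed_univ (X := K))
  obtain ⟨b, hb⟩ := exists_isPeakFamily hc₁
  obtain ⟨u, hu⟩ := exists_isPeakFamily hc₂
  obtain ⟨m, hm, hmd⟩ := exists_weakStar_dense_seq_continuousMap (K := K)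
  have hfin₂ : (K₂ \ derivedSet K₂).Finite :=
    (finite_of_disjoint_derivedSet hc₂ subset_rfl (by simp [h₃])).subset Set.sdiff_subset
  have := hfin₂.fintype
  -- The correction kills the top-level peaks `u x`; it leaves the values at `b δ` unchanged because
  -- these vanish on `K₂`. The bound `B` is finite because the top level is.
  let g : ↥(K₁ \ derivedSet K₁) → NormedDual C(K, ℝ) := fun γ =>
    evalDual (γ : K) - ∑ x : ↥(K₂ \ derivedSet K₂), u x γ • evalDual (x : K)
  have hg : ∀ γ y, g γ y = y γ - ∑ x : ↥(K₂ \ derivedSet K₂), u x γ * y x := fun γ y => by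
    simp [g]
  have ha₁ : ∀ i, ∀ x ∈ K₁, a i x = 0 := fun i x hx =>
    ha.ne i x trivial fun h => i.2.2 (h₁.symm ▸ h ▸ hx)
  have hb₂ : ∀ γ, ∀ x ∈ K₂, b γ x = 0 := fun γ x hx =>
    hb.ne γ x (h₂₁ hx) fun h => γ.2.2 (h₂.symm ▸ h ▸ hx)
  have hgb : ∀ γ δ, g γ (b δ) = b δ γ := fun γ δ => by
    rw [hg, Finset.sum_eq_zero fun x _ => by rw [hb₂ δ x x.2.1, mul_zero], sub_zero]
  refine ⟨{ e := Sum.elim a u, f := b, g := g, B := 1 + Fintype.card ↥(K₂ \ derivedSet K₂),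
            g_norm_le := ?_, g_e := ?_, g_f_self := fun γ => by rw [hgb, hb.self],
            g_f_ne := fun γ δ hne => by
              rw [hgb, hb.ne δ γ γ.2.1 fun h => hne (Subtype.ext h)],
            exists_absorbing := ?_, m := m, m_norm_le := hm, m_dense := hmd }, ?_⟩
  · exact fun γ => norm_sub_sum_smul_le (norm_evalDual_le_one _) (fun _ => norm_evalDual_le_one _)
      (fun x => hu.nonneg x γ) fun x => hu.le_one x γ
  · rintro γ (i | x)
    · rw [Sum.elim_inl, hg, ha₁ i γ γ.2.1,
        Finset.sum_eq_zero fun x _ => by rw [ha₁ i x (h₂₁ x.2.1), mul_zero], sub_zero]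
    · rw [Sum.elim_inr, hg, Finset.sum_eq_single x, hu.self, mul_one, sub_self]
      · intro x' _ hne
        rw [hu.ne x x' x'.2.1 fun h => hne (Subtype.ext h), mul_zero]
      · simp
  · intro A
    -- On `K₁` the sum is at most `1`, so this closed set consists of isolated points of `K` and is
    -- finite. Removing the values there by bottom-level peaks leaves a remainder dominated by a sum
    -- below `2`.
    have hcl : IsClosed {x | 2 ≤ (∑ γ ∈ A, b γ) x} :=
      isClosed_le continuous_const (∑ γ ∈ A, b γ).continuous
    obtain ⟨S, hS⟩ := ha.exists_interpolation hcl (Set.subset_univ _) (fun x hx hx' => by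
      rw [h₁] at hx'
      linarith [hb.sum_le_one A hx', show (2 : ℝ) ≤ _ from hx])
    refine ⟨S.map .inl, fun c hc => ?_⟩
    obtain ⟨w, hw, hw1, hw2⟩ := hS (∑ γ ∈ A, c γ • b γ)
    refine ⟨w, Submodule.span_mono ?_ hw, ?_⟩
    · rintro _ ⟨i, hi, rfl⟩
      exact ⟨.inl i, by simpa using hi, rfl⟩
    · rw [ContinuousMap.norm_le _ zero_le_two]
      intro x
      by_cases hx : 2 ≤ (∑ γ ∈ A, b γ) x
      · rw [ContinuousMap.sub_apply, hw1 x hx, sub_self, norm_zero]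
        exact zero_le_two
      · rw [ContinuousMap.sub_apply, hw2 x trivial hx, sub_zero]
        refine le_trans ?_ (not_le.1 hx).le
        rw [ContinuousMap.sum_apply, ContinuousMap.sum_apply]
        refine norm_sum_le_of_le _ fun γ _ => ?_
        rw [ContinuousMap.smul_apply, norm_smul, Real.norm_of_nonneg (hb.nonneg γ x)]
        exact mul_le_of_le_one_left (hb.nonneg γ x) (hc γ)
  · refine Metric.dense_iff.2 fun y ε hε => ?_
    -- The approximation runs from the top level down: each error is small on one derivative, which
    -- is the hypothesis needed on the next larger set.
    obtain ⟨w₂, hw₂, h2⟩ := hu.exists_approx hc₂ y (half_pos hε) (by simp [h₃])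
    obtain ⟨w₁, hw₁, h1⟩ := hb.exists_approx hc₁ (y - w₂) (half_pos hε) (by rwa [h₂])
    obtain ⟨w₀, hw₀, h0⟩ := ha.exists_approx isClosed_univ (y - w₂ - w₁) (half_pos hε)
      (by rwa [h₁])
    refine ⟨w₂ + w₁ + w₀, ?_, ?_⟩
    · rw [Metric.mem_ball, dist_comm, dist_eq_norm]
      refine lt_of_le_of_lt ?_ (half_lt_self hε)
      rw [ContinuousMap.norm_le _ (half_pos hε).le]
      intro x
      rw [show (y - (w₂ + w₁ + w₀)) x = (y - w₂ - w₁) x - w₀ x by simp; ring]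
      exact (h0 x trivial).le
    · refine Submodule.add_mem _ (Submodule.add_mem _ ?_ ?_) ?_
      · refine Submodule.span_mono ?_ hw₂
        rintro _ ⟨x, rfl⟩
        exact Or.inl ⟨.inr x, rfl⟩
      · exact Submodule.span_mono Set.subset_union_right hw₁
      · refine Submodule.span_mono ?_ hw₀
        rintro _ ⟨x, rfl⟩
        exact Or.inl ⟨.inl x, rfl⟩

end System

/-! ### Derivatives of a space of height three -/

/-- The first Cantor-Bendixson derivatives of a space of height three. -/
theorem derivedSet_of_scatteredHeight_eq_three {K : Type u} [TopologicalSpace K] [T1Space K]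
    (h : scatteredHeight K = 3) :
    (derivedSet (derivedSet (Set.univ : Set K))).Nonempty ∧
      derivedSet (derivedSet (derivedSet (Set.univ : Set K))) = ∅ := by
  have hsucc : ∀ a : Ordinal, CantorBendixson.iteratedDerivedSet (Set.univ : Set K) (a + 1) =
      derivedSet (CantorBendixson.iteratedDerivedSet Set.univ a) := fun a => by
    rw [CantorBendixson.iteratedDerivedSet_succ,
      (CantorBendixson.isClosed_iteratedDerivedSet isClosed_univ a).relDerivedSet_eq]
  have h2 : CantorBendixson.iteratedDerivedSet (Set.univ : Set K) 2 =
      derivedSet (derivedSet Set.univ) := by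
    rw [show (2 : Ordinal) = 0 + 1 + 1 by norm_num, hsucc, hsucc,
      CantorBendixson.iteratedDerivedSet_zero]
  have h3 : CantorBendixson.iteratedDerivedSet (Set.univ : Set K) 3 =
      derivedSet (derivedSet (derivedSet Set.univ)) := by
    rw [show (3 : Ordinal) = 2 + 1 by norm_num, hsucc, h2]
  -- The infimum of an empty set of ordinals is `0`, so height `3` forces the infimum to be
  -- attained.
  have hne : {α : Ordinal | CantorBendixson.iteratedDerivedSet (Set.univ : Set K) α = ∅}.Nonempty := by
    by_contra hemp
    rw [Set.not_nonempty_iff_eq_empty] at hemp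
    rw [scatteredHeight, hemp, Ordinal.sInf_empty] at h
    norm_num at h
  have hmem := csInf_mem hne
  rw [← scatteredHeight, h] at hmem
  refine ⟨?_, h3 ▸ hmem⟩
  rw [← h2, Set.nonempty_iff_ne_empty]
  intro h2e
  have : scatteredHeight K ≤ 2 := csInf_le' h2e
  rw [h] at this
  norm_num at this

/-- Otherwise `D` would be finite and have no accumulation points. This forces the weight `κ` to be
infinite. -/
theorem infinite_isolated_derivedSet {K : Type u} [TopologicalSpace K] [CompactSpace K] [T1Space K]
    {D : Set K} (h : (derivedSet D).Nonempty) (h' : derivedSet (derivedSet D) = ∅) :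
    (D \ derivedSet D).Infinite := by
  intro hfin
  have hfin' : (derivedSet D).Finite :=
    finite_of_disjoint_derivedSet (isClosed_derivedSet D) subset_rfl (by simp [h'])
  have hD : D.Finite := (hfin.union hfin').subset (by simp)
  exact h.ne_empty (derivedSet_eq_empty_of_finite hD)

/-! ### Twisted sums of `c₀` as sequences of functionals -/

/-- Functionals that are asymptotically bounded by `c` pointwise are eventually bounded by `c + 1`
on a finite-dimensional subspace, if they are equicontinuous there. -/
theorem eventually_bound_on_finiteDimensional {Y : Type*} [NormedAddCommGroup Y] [NormedSpace ℝ Y]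
    (V : Submodule ℝ Y) [FiniteDimensional ℝ V] (t : ℕ → Y →ₗ[ℝ] ℝ) {c L : ℝ}
    (hL : ∀ k, ∀ y ∈ V, |t k y| ≤ L * ‖y‖)
    (h : ∀ y, ∀ δ > 0, ∀ᶠ k in atTop, |t k y| ≤ c * ‖y‖ + δ) :
    ∀ᶠ k in atTop, ∀ y ∈ V, |t k y| ≤ (c + 1) * ‖y‖ := by
  have hcomp : IsCompact (Metric.sphere (0 : V) 1) := isCompact_sphere _ _
  have hsph : ∀ᶠ k in atTop, ∀ y ∈ Metric.sphere (0 : V) 1, |t k y| ≤ c + 1 := by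
    refine hcomp.induction_on (p := fun s => ∀ᶠ k in atTop, ∀ y ∈ s, |t k (y : V)| ≤ c + 1)
      (by simp) (fun s s' hs h' => h'.mono fun k hk y hy => hk y (hs hy))
      (fun s s' h₁ h₂ => ?_) fun y₀ hy₀ => ?_
    · filter_upwards [h₁, h₂] with k hk₁ hk₂ y hy
      exact hy.elim (hk₁ y) (hk₂ y)
    -- Moving within this ball costs at most `1 / 2`, and the asymptotic bound at `y₀` is used with
    -- `δ = 1 / 2`; together they give the summand `1`.
    · refine ⟨Metric.ball y₀ (1 / (2 * (|L| + 1))),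
        mem_nhdsWithin_of_mem_nhds (Metric.ball_mem_nhds _ (by positivity)), ?_⟩
      filter_upwards [h y₀ (1 / 2) (by norm_num)] with k hk y hy
      have hy₀' : ‖(y₀ : Y)‖ = 1 := by simpa using hy₀
      rw [hy₀'] at hk
      have h1 : |t k ((y - y₀ : V) : Y)| ≤ 1 / 2 := by
        refine (hL k _ (y - y₀).2).trans ?_
        have : ‖((y - y₀ : V) : Y)‖ < 1 / (2 * (|L| + 1)) := by
          simpa [dist_eq_norm] using hy
        calc L * _ ≤ (|L| + 1) * (1 / (2 * (|L| + 1))) := by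
              gcongr
              linarith [le_abs_self L]
          _ = 1 / 2 := by field_simp
      have : t k (y : Y) = t k ((y - y₀ : V) : Y) + t k y₀ := by
        rw [← map_add]; simp
      rw [this]
      exact (abs_add_le _ _).trans (by linarith)
  filter_upwards [hsph] with k hk y hy
  by_cases hy0 : y = 0
  · simp [hy0]
  have hn : 0 < ‖y‖ := norm_pos_iff.2 hy0
  have := hk (‖y‖⁻¹ • ⟨y, hy⟩) (by simp [norm_smul, hn.ne'])
  simp only [Submodule.coe_smul, map_smul, smul_eq_mul, abs_mul, abs_inv, abs_norm] at this
  rwa [inv_mul_le_iff₀ hn, mul_comm] at this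

section

variable {Z : Type u} {X : Type v} {Y : Type w}
  [NormedAddCommGroup Z] [NormedSpace ℝ Z] [CompleteSpace Z]
  [NormedAddCommGroup X] [NormedSpace ℝ X] [CompleteSpace X]
  [NormedAddCommGroup Y] [NormedSpace ℝ Y] [CompleteSpace Y]
  {i : Z →L[ℝ] X} {q : X →L[ℝ] Y}

/-- Bounded families of functionals on the subspace of a twisted sum extend to bounded families. -/
theorem IsTwistedSum.exists_extension (h : IsTwistedSum i q) : ∃ L : ℝ, 0 ≤ L ∧
    ∀ φ : StrongDual ℝ Z, ‖φ‖ ≤ 1 → ∃ ψ : StrongDual ℝ X, ‖ψ‖ ≤ L ∧ ∀ z, ψ (i z) = φ z := by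
  have hrange : Set.range i = (LinearMap.ker q.toLinearMap : Set X) := by
    ext x
    exact (h.exact x).symm
  have hclosed : IsClosed (Set.range i) := by
    rw [hrange]
    exact ContinuousLinearMap.isClosed_ker q
  -- By the open mapping theorem `i` is an isomorphism onto its closed range; the norm of its
  -- inverse is the uniform constant.
  let E := ContinuousLinearMap.equivRange h.injective hclosed
  let T : i.range →L[ℝ] Z := E.symm.toContinuousLinearMap
  refine ⟨‖T‖, T.opNorm_nonneg, fun φ hφ => ?_⟩
  obtain ⟨ψ, hψ, hn⟩ := exists_extension_norm_eq _ (φ.comp T)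
  refine ⟨ψ, ?_, fun z => ?_⟩
  · rw [hn]
    exact (ContinuousLinearMap.opNorm_comp_le _ _).trans
      (mul_le_of_le_one_left T.opNorm_nonneg hφ)
  · have := hψ (E z)
    rw [show ((E z : _) : X) = i z from rfl] at this
    rw [this]
    simp [T]

/-- The quotient map of a twisted sum lifts vectors with control of the norm, modulo the
subspace. -/
theorem IsTwistedSum.exists_decomposition (h : IsTwistedSum i q) : ∃ c : ℝ, 0 ≤ c ∧
    ∀ x, ∃ x' z, x = x' + i z ∧ ‖x'‖ ≤ c * ‖q x‖ := by
  obtain ⟨c, hc, hq⟩ := q.exists_preimage_norm_le h.surjective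
  refine ⟨c, hc.le, fun x => ?_⟩
  obtain ⟨x', hx', hn⟩ := hq (q x)
  obtain ⟨z, hz⟩ := (h.exact (x - x')).1 (by rw [map_sub, hx', sub_self])
  exact ⟨x', z, by rw [hz]; abel, hn⟩

end

theorem ZeroAtInftyContinuousMap.tendsto_atTop (z : C₀(ℕ, ℝ)) : Tendsto z atTop (𝓝 0) := by
  have := z.zero_at_infty'
  rwa [cocompact_eq_cofinite, Nat.cofinite_eq_atTop] at this

/-- A bounded sequence of functionals converging pointwise to zero defines an operator
into `c₀`. -/
theorem exists_operator_cZero {X : Type*} [NormedAddCommGroup X] [NormedSpace ℝ X]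
    (r : ℕ → StrongDual ℝ X) {D : ℝ} (hD : ∀ k, ‖r k‖ ≤ D)
    (hr : ∀ x, Tendsto (fun k => r k x) atTop (𝓝 0)) :
    ∃ R : X →L[ℝ] C₀(ℕ, ℝ), ∀ x k, R x k = r k x := by
  let R₀ : X →ₗ[ℝ] C₀(ℕ, ℝ) :=
    { toFun := fun x => ⟨⟨fun k => r k x, continuous_of_discreteTopology⟩, by
        rw [cocompact_eq_cofinite, Nat.cofinite_eq_atTop]; exact hr x⟩
      map_add' := fun x y => by ext k; simp
      map_smul' := fun a x => by ext k; simp }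
  refine ⟨R₀.mkContinuous D fun x => ?_, fun x k => rfl⟩
  have hD0 : 0 ≤ D := (norm_nonneg _).trans (hD 0)
  rw [← ZeroAtInftyContinuousMap.norm_toBCF_eq_norm]
  refine (BoundedContinuousFunction.norm_le (by positivity)).2 fun k => ?_
  exact ((r k).le_opNorm x).trans (by gcongr; exact hD k)

/-- The subspace of vectors on which a sequence of functionals tends to zero. -/
def asymptoticKernel {X : Type*} [NormedAddCommGroup X] [NormedSpace ℝ X]
    (r : ℕ → StrongDual ℝ X) : Submodule ℝ X where
  carrier := {x | Tendsto (fun k => r k x) atTop (𝓝 0)}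
  zero_mem' := by simp
  add_mem' {a b} ha hb := by
    have : Tendsto (fun k => r k a + r k b) atTop (𝓝 (0 + 0)) := Tendsto.add ha hb
    simpa using this
  smul_mem' c a ha := by
    have : Tendsto (fun k => c * r k a) atTop (𝓝 (c * 0)) := Tendsto.const_mul c ha
    simpa using this

theorem isClosed_asymptoticKernel {X : Type*} [NormedAddCommGroup X] [NormedSpace ℝ X]
    {r : ℕ → StrongDual ℝ X} {D : ℝ} (hD : ∀ k, ‖r k‖ ≤ D) :
    IsClosed (asymptoticKernel r : Set X) := by
  have hD0 : 0 ≤ D := (norm_nonneg _).trans (hD 0)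
  refine isClosed_of_closure_subset fun x hx => ?_
  refine Metric.tendsto_atTop.2 fun ε hε => ?_
  obtain ⟨y, hy, hxy⟩ := Metric.mem_closure_iff.1 hx (ε / (2 * (D + 1))) (by positivity)
  obtain ⟨N, hN⟩ := Metric.tendsto_atTop.1 (show Tendsto (fun k => r k y) atTop (𝓝 0) from hy)
    (ε / 2) (by positivity)
  refine ⟨N, fun k hk => ?_⟩
  have h1 := hN k hk
  rw [dist_eq_norm, sub_zero] at h1 ⊢
  have h2 : ‖r k (x - y)‖ ≤ ε / 2 := by
    refine ((r k).le_opNorm _).trans ?_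
    rw [dist_eq_norm] at hxy
    calc _ ≤ (D + 1) * (ε / (2 * (D + 1))) := by
          gcongr
          linarith [hD k]
      _ = ε / 2 := by field_simp
  rw [← sub_add_cancel x y, map_add]
  linarith [norm_add_le (r k (x - y)) (r k y)]

/-- A twisted sum of `c₀` and `Y` gives rise to a sequence of linear functionals on `Y`, eventually
bounded on every finite-dimensional subspace; the twisted sum is trivial if this sequence is
asymptotic to a bounded sequence of functionals on a set with dense span. -/
theorem IsTwistedSum.exists_functionals {X : Type v} {Y : Type w}
    [NormedAddCommGroup X] [NormedSpace ℝ X] [CompleteSpace X]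
    [NormedAddCommGroup Y] [NormedSpace ℝ Y] [CompleteSpace Y]
    {i : C₀(ℕ, ℝ) →L[ℝ] X} {q : X →L[ℝ] Y} (h : IsTwistedSum i q) :
    ∃ (t : ℕ → Y →ₗ[ℝ] ℝ) (C : ℝ), 0 < C ∧
      (∀ F : Set Y, F.Finite → ∀ᶠ k in atTop, ∀ y ∈ Submodule.span ℝ F, |t k y| ≤ C * ‖y‖) ∧
      ((∃ (D : ℝ) (μ : ℕ → StrongDual ℝ Y) (F : Set Y), (∀ k, ‖μ k‖ ≤ D) ∧
          Dense (Submodule.span ℝ F : Set Y) ∧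
          ∀ y ∈ F, Tendsto (fun k => μ k y - t k y) atTop (𝓝 0)) →
        IsTrivialTwistedSum i q) := by
  obtain ⟨L, hL, hext⟩ := h.exists_extension
  obtain ⟨c, hc, hdec⟩ := h.exists_decomposition
  have hev : ∀ k, ∃ ψ : StrongDual ℝ X, ‖ψ‖ ≤ L ∧ ∀ z : C₀(ℕ, ℝ), ψ (i z) = z k := fun k => by
    let φ : C₀(ℕ, ℝ) →ₗ[ℝ] ℝ :=
      { toFun := fun z => z k, map_add' := fun _ _ => rfl, map_smul' := fun _ _ => rfl }
    obtain ⟨ψ, hψ, he⟩ := hext (φ.mkContinuous 1 fun z => by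
      rw [one_mul, ← ZeroAtInftyContinuousMap.norm_toBCF_eq_norm]
      exact z.toBCF.norm_coe_le_norm k) (LinearMap.mkContinuous_norm_le _ zero_le_one _)
    exact ⟨ψ, hψ, he⟩
  choose ψ hψ hψi using hev
  obtain ⟨s, hs⟩ := LinearMap.exists_rightInverse_of_surjective q.toLinearMap
    (LinearMap.range_eq_top.2 h.surjective)
  have hqs : ∀ y, q (s y) = y := fun y => LinearMap.congr_fun hs y
  refine ⟨fun k => (ψ k).toLinearMap ∘ₗ s, L * c + 1, by positivity, fun F hF => ?_, ?_⟩
  · have := FiniteDimensional.span_of_finite ℝ hF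
    -- The section is continuous on a finite-dimensional span. Its norm `‖sV‖` enters only the
    -- equicontinuity constant, not the final bound.
    let sV := LinearMap.toContinuousLinearMap (s.domRestrict (Submodule.span ℝ F))
    refine eventually_bound_on_finiteDimensional (c := L * c) (L := L * ‖sV‖) _ _
      (fun k y hy => ?_) fun y δ hδ => ?_
    · calc |ψ k (s y)| ≤ ‖ψ k‖ * ‖sV ⟨y, hy⟩‖ := (ψ k).le_opNorm _
        _ ≤ L * (‖sV‖ * ‖y‖) := by
          gcongr
          · exact hψ k
          · exact sV.le_opNorm _
        _ = L * ‖sV‖ * ‖y‖ := by ring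
    -- Up to an element of `c₀`, whose coordinates tend to zero, `s y` is a lift of norm at most `c
    -- * ‖y‖`.
    · obtain ⟨x', z, hx, hn⟩ := hdec (s y)
      rw [hqs] at hn
      have := z.tendsto_atTop.norm
      rw [norm_zero] at this
      filter_upwards [this.eventually_le_const hδ] with k hk
      change |ψ k (s y)| ≤ _
      rw [hx, map_add, hψi]
      refine (abs_add_le _ _).trans (add_le_add ?_ hk)
      calc |ψ k x'| ≤ ‖ψ k‖ * ‖x'‖ := (ψ k).le_opNorm _
        _ ≤ L * (c * ‖y‖) := by gcongr; exact hψ k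
        _ = L * c * ‖y‖ := by ring
  · rintro ⟨D, μ, F, hμ, hF, hlim⟩
    have hD : 0 ≤ D := (norm_nonneg _).trans (hμ 0)
    let r : ℕ → StrongDual ℝ X := fun k => ψ k - (μ k).comp q
    have hrn : ∀ k, ‖r k‖ ≤ L + D * ‖q‖ := fun k =>
      (norm_sub_le _ _).trans (add_le_add (hψ k) ((ContinuousLinearMap.opNorm_comp_le _ _).trans
        (by gcongr; exact hμ k)))
    have hri : ∀ k z, r k (i z) = z k := fun k z => by
      simp [r, hψi, (h.exact (i z)).2 ⟨z, rfl⟩]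
    have hrz : ∀ x, ∃ z : C₀(ℕ, ℝ), ∀ k, r k x = z k + r k (s (q x)) := fun x => by
      obtain ⟨z, hz⟩ := (h.exact (x - s (q x))).1 (by rw [map_sub, hqs, sub_self])
      refine ⟨z, fun k => ?_⟩
      rw [← hri, ← map_add, hz, sub_add_cancel]
    -- `x` and `s (q x)` differ by an element of `c₀`, so convergence does not depend on the lift.
    -- This makes `V` closed although `s` may be discontinuous: its preimage under the quotient map
    -- `q` is the closed asymptotic kernel.
    have hrs : ∀ x, Tendsto (fun k => r k (s (q x))) atTop (𝓝 0) ↔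
        Tendsto (fun k => r k x) atTop (𝓝 0) := fun x => by
      obtain ⟨z, hz⟩ := hrz x
      refine ⟨fun h => ?_, fun h => ?_⟩
      · simpa [hz] using z.tendsto_atTop.add h
      · simpa [hz] using h.sub z.tendsto_atTop
    let V : Submodule ℝ Y := (asymptoticKernel r).comap s
    have hV : IsClosed (V : Set Y) := by
      rw [← (q.isQuotientMap h.surjective).isClosed_preimage]
      convert isClosed_asymptoticKernel hrn using 1
      ext x
      exact hrs x
    have hFV : F ⊆ V := fun y hy => by
      have := (hlim y hy).neg
      rw [neg_zero] at this
      refine this.congr fun k => ?_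
      simp [r, hqs]
    have hVtop : ∀ y, y ∈ V := fun y =>
      closure_minimal (Submodule.span_le.2 hFV) hV (hF y)
    obtain ⟨R, hR⟩ := exists_operator_cZero r hrn fun x => (hrs x).1 (hVtop (q x))
    exact ⟨h, R, by ext z k; simp [hR, hri]⟩

/-! ### The main theorem -/

theorem theorem8p7 (κ : Cardinal.{u}) (hMA : MartinMA κ)
    (K : Type u) [TopologicalSpace K] [CompactSpace K] [T2Space K]
    [TopologicalSpace.SeparableSpace K]
    (hscat : IsScatteredSpace K) (hheight : scatteredHeight K = 3) (hweight : topWeight K = κ)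
    (X : Type v) [NormedAddCommGroup X] [NormedSpace ℝ X] [CompleteSpace X]
    (i : C₀(ℕ, ℝ) →L[ℝ] X) (q : X →L[ℝ] C(K, ℝ)) (hX : IsTwistedSum i q) :
    IsTrivialTwistedSum i q := by
  obtain ⟨hne, hemp⟩ := derivedSet_of_scatteredHeight_eq_three hheight
  obtain ⟨Φ, hΦ⟩ := exists_cZeroSystem (K := K) rfl rfl hemp
  have hΓ : #↥(derivedSet (Set.univ : Set K) \ derivedSet (derivedSet Set.univ)) ≤ κ :=
    hweight ▸ mk_isolated_le_topWeight (isClosed_derivedSet _)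
  have hκ : ℵ₀ ≤ κ :=
    (Cardinal.infinite_iff.1 (infinite_isolated_derivedSet hne hemp).to_subtype).trans hΓ
  have hcount := (countable_isolated (K := K)).to_subtype
  have hfin : Finite ↥(derivedSet (derivedSet (Set.univ : Set K)) \
      derivedSet (derivedSet (derivedSet Set.univ))) :=
    ((finite_of_disjoint_derivedSet (isClosed_derivedSet _) subset_rfl (by simp [hemp])).subset
      Set.sdiff_subset).to_subtype
  obtain ⟨t, C, hC, ht, htriv⟩ := hX.exists_functionals
  obtain ⟨D, μ, hμ, he, hf⟩ := Φ.exists_bounded_asymptotic hMA hκ hΓ t hC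
    fun S A => eventually_atTop.1 (ht _ (Φ.finite_gens S A))
  refine htriv ⟨D, μ, _, hμ, hΦ, ?_⟩
  rintro _ (⟨j, rfl⟩ | ⟨γ, rfl⟩)
  · exact he j
  · exact hf γ
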